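/- Let $G=(V,E)$ be a finite simple graph with $n=|V|\ge 1$ vertices and $m=|E|$ edges, adjacency matrix $A$ and diagonal degree matrix $D$. Let $\mu_1\ge\dots\ge\mu_n$, $\theta_1\ge\dots\ge\theta_n$ and $\delta_1\ge\dots\ge\delta_n$ be the eigenvalues of $A$, of the Laplacian $D-A$ and of the signless Laplacian $D+A$, respectively. The orthogonal rank $\xi(G)$ is the smallest positive integer $d$ for which there are non-zero vectors $x_v\in\mathbb{C}^d$ $(v\in V)$ with $x_v^\dagger x_w=0$ for all $vw\in E$. A vectorial $c$-coloring of $G$ is a family of vectors $(x_{v,i})_{v\in V,\,0\le i<c}$ in a complex Hilbert space such that $\langle x_{v,i},x_{w,j}\rangle\ge 0$ for all $v,w\in V$ and all $i,j$; $\sum_i x_{v,i}=\sum_i x_{w,i}$ and $\bigl\|\sum_i x_{v,i}\bigr\|=1$ for all $v,w\in V$; $\langle x_{v,i},x_{v,j}\rangle=0$ for all $v\in V$ and $i\ne j$; and $\langle x_{v,i},x_{w,i}\rangle=0$ for all $vw\in E$ and all $i$. The vectorial chromatic number $\chi_{\mathrm{vect}}(G)$ is the least $c$ for which $G$ has a vectorial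 $c$-coloring. Then \[ 1+\max\left(\frac{\mu_1}{|\mu_n|},\ \frac{2m}{2m-n\delta_n},\ \frac{\mu_1}{\mu_1-\delta_1+\theta_1}\right)\ \le\ \chi_{\mathrm{vect}}(G)\ \le\ \xi(G). \] If $G$ has at least one edge, the three denominators are positive; if $G$ has no edge, each quotient is $0/0$ and is read as $0$. -/

import Mathlib

namespace SimpleGraph

section Parameters

variable {V : Type*} (G : SimpleGraph V)

/-- An orthogonal representation of `G` in `ℂ^d`: nonzero vectors, one for each vertex, such that
adjacent vertices receive orthogonal vectors. -/
structure IsOrthogonalRep (d : ℕ) (x : V → EuclideanSpace ℂ (Fin d)) : Prop where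
  ne_zero : ∀ v, x v ≠ 0
  inner_eq_zero : ∀ v w, G.Adj v w → inner ℂ (x v) (x w) = 0

/-- The orthogonal rank `ξ(G)`: the smallest positive `d` such that `G` has an orthogonal
representation in `ℂ^d`. -/
noncomputable def orthogonalRank : ℕ :=
  sInf {d : ℕ | 0 < d ∧ ∃ x : V → EuclideanSpace ℂ (Fin d), G.IsOrthogonalRep d x}

open scoped ComplexOrder in
/-- A vectorial `c`-coloring of `G` in the Hilbert space `H`. In `inner_nonneg` the order is that
of `ℂ`: the inner product is real and nonnegative. -/
structure IsVectorialColoring (c : ℕ) {H : Type*} [NormedAddCommGroup H] [InnerProductSpace ℂ H]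
    (x : V → Fin c → H) : Prop where
  inner_nonneg : ∀ v w i j, 0 ≤ inner ℂ (x v i) (x w j)
  sum_eq_sum : ∀ v w, ∑ i, x v i = ∑ i, x w i
  norm_sum : ∀ v, ‖∑ i, x v i‖ = 1
  inner_self_eq_zero : ∀ v i j, i ≠ j → inner ℂ (x v i) (x v j) = 0
  inner_adj_eq_zero : ∀ v w, G.Adj v w → ∀ i, inner ℂ (x v i) (x w i) = 0

/-- `G` has a vectorial `c`-coloring in some Hilbert space. (For finite `G` the vectors span a
finite-dimensional space, so the universe of `H` is immaterial.) -/
def VectoriallyColorable (c : ℕ) : Prop :=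
  ∃ (H : Type) (_ : NormedAddCommGroup H) (_ : InnerProductSpace ℂ H) (_ : CompleteSpace H)
    (x : V → Fin c → H), G.IsVectorialColoring c x

/-- The vectorial chromatic number: the least `c` such that `G` has a vectorial `c`-coloring. -/
noncomputable def vectorialChromaticNumber : ℕ :=
  sInf {c : ℕ | G.VectoriallyColorable c}

/-- The set whose minimum is the orthogonal rank is nonempty. -/
theorem exists_isOrthogonalRep [Fintype V] [Nonempty V] :
    {d : ℕ | 0 < d ∧ ∃ x : V → EuclideanSpace ℂ (Fin d), G.IsOrthogonalRep d x}.Nonempty := by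
  refine ⟨Fintype.card V, Fintype.card_pos,
    fun v => EuclideanSpace.single (Fintype.equivFin V v) 1, ?_, ?_⟩
  · intro v h
    simpa using congrArg norm h
  · intro v w h
    have h' : Fintype.equivFin V v ≠ Fintype.equivFin V w := fun e =>
      h.ne ((Fintype.equivFin V).injective e)
    simp [EuclideanSpace.inner_single_left, h']

open scoped ComplexOrder in
/-- The set whose minimum is the vectorial chromatic number is nonempty. -/
theorem exists_vectoriallyColorable [Fintype V] :
    {c : ℕ | G.VectoriallyColorable c}.Nonempty := by
  refine ⟨Fintype.card V, ℂ, inferInstance, inferInstance, inferInstance,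
    fun v i => if i = Fintype.equivFin V v then 1 else 0, ?_, ?_, ?_, ?_, ?_⟩
  · intro v w i j
    split_ifs <;> simp
  · intro v w
    simp
  · intro v
    simp
  · intro v i j h
    split_ifs with h1 h2
    · exact absurd (h1.trans h2.symm) h
    all_goals simp
  · intro v w h i
    split_ifs with h1 h2
    · exact absurd ((Fintype.equivFin V).injective (h1.symm.trans h2)) h.ne
    all_goals simp

end Parameters

section Spectra

variable {V : Type*} [Fintype V] [DecidableEq V] (G : SimpleGraph V) [DecidableRel G.Adj]

/-- The signless Laplacian `Q = D + A`. -/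
def signlessLapMatrix : Matrix V V ℝ := G.degMatrix ℝ + G.adjMatrix ℝ

theorem isHermitian_signlessLapMatrix : G.signlessLapMatrix.IsHermitian :=
  (G.isHermitian_degMatrix ℝ).add (G.isHermitian_adjMatrix ℝ)

/-- The eigenvalues `μ` of the adjacency matrix, with multiplicity, in nonincreasing order. -/
noncomputable def adjEigenvalues : Fin (Fintype.card V) → ℝ :=
  (G.isHermitian_adjMatrix ℝ).eigenvalues₀

/-- The eigenvalues `θ` of the Laplacian `D - A`, with multiplicity, in nonincreasing order. -/
noncomputable def lapEigenvalues : Fin (Fintype.card V) → ℝ :=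
  (G.isHermitian_lapMatrix ℝ).eigenvalues₀

/-- The eigenvalues `δ` of the signless Laplacian `D + A`, with multiplicity, in nonincreasing
order. -/
noncomputable def signlessLapEigenvalues : Fin (Fintype.card V) → ℝ :=
  G.isHermitian_signlessLapMatrix.eigenvalues₀

end Spectra

/-- The position of the first (largest) eigenvalue in a list indexed by `Fin |V|`. -/
def firstIdx (V : Type*) [Fintype V] [Nonempty V] : Fin (Fintype.card V) :=
  ⟨0, Fintype.card_pos⟩

/-- The position of the last (smallest) eigenvalue in a list indexed by `Fin |V|`. -/
def lastIdx (V : Type*) [Fintype V] [Nonempty V] : Fin (Fintype.card V) :=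
  ⟨Fintype.card V - 1, Nat.sub_lt Fintype.card_pos Nat.one_pos⟩

end SimpleGraph

/-
Both bounds pass through positive semidefinite matrices `N` with diagonal `c - 1`, entries `-1` on
the edges and all entries at least `-1`; such an `N` exists exactly when there is a vectorial
`c`-coloring. If `M` is the matrix of the sums `∑ i, ⟪x v i, x w i⟫` of a coloring, then `c M - J`
is such a matrix. Conversely, the Kronecker product of `N` with the Gram matrix `c I - J` of a
simplex is, after an affine normalization, the Gram matrix of a coloring.

The lower bounds follow from Schur's product theorem for `N` and `diag b + A ≥ 0`, which gives
`A ≤ (c - 1) diag b`, with `b` equal to `-μₙ`, to `deg - δₙ` and to `θ₁ - deg` (the last one is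
combined with `A ≤ μ₁`). For the upper bound, unit vectors `u v ∈ ℂᵈ`, orthogonal along the edges,
give the matrix with entries `d |⟪u v, u w⟫|² - 1`: the projections onto the lines `ℂ u v` have
trace one and the identity has squared Hilbert-Schmidt norm `d`.
-/

namespace VectorialColoring

open Matrix SimpleGraph
open scoped MatrixOrder Kronecker

section Eigenvalues

variable {𝕜 n : Type*} [RCLike 𝕜] [Fintype n] [DecidableEq n] [Nonempty n] {A : Matrix n n 𝕜}
  {r : ℝ}

theorem eigenvalues₀_firstIdx_le_iff (hA : A.IsHermitian) :
    hA.eigenvalues₀ (firstIdx n) ≤ r ↔ A ≤ algebraMap ℝ (Matrix n n 𝕜) r := by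
  rw [le_algebraMap_iff_spectrum_le hA.isSelfAdjoint, hA.spectrum_real_eq_range_eigenvalues,
    Set.forall_mem_range]
  refine ⟨fun h i => (hA.eigenvalues₀_antitone (Nat.zero_le _)).trans h, fun h => ?_⟩
  simpa [IsHermitian.eigenvalues] using h (Fintype.equivOfCardEq (Fintype.card_fin _) (firstIdx n))

theorem le_eigenvalues₀_lastIdx_iff (hA : A.IsHermitian) :
    r ≤ hA.eigenvalues₀ (lastIdx n) ↔ algebraMap ℝ (Matrix n n 𝕜) r ≤ A := by
  rw [algebraMap_le_iff_le_spectrum hA.isSelfAdjoint, hA.spectrum_real_eq_range_eigenvalues,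
    Set.forall_mem_range]
  refine ⟨fun h i => h.trans (hA.eigenvalues₀_antitone (Nat.le_sub_one_of_lt (Fin.is_lt _))),
    fun h => ?_⟩
  simpa [IsHermitian.eigenvalues] using h (Fintype.equivOfCardEq (Fintype.card_fin _) (lastIdx n))

end Eigenvalues

section Gram

variable {n : Type*}

theorem posSemidef_norm_sq_smul_gram_sub_one [Finite n] {E : Type*} [NormedAddCommGroup E]
    [InnerProductSpace ℝ E] {e : E} {y : n → E} (he : ∀ v, inner ℝ e (y v) = 1) :
    (‖e‖ ^ 2 • gram ℝ y - of fun _ _ => 1).PosSemidef := by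
  have hone : gram ℝ (innerSL ℝ e ∘ y) = of fun _ _ => 1 := by
    ext
    simp [he]
  simpa only [hone, innerSL_apply_norm] using posSemidef_opNorm_smul_gram_sub_gram y (innerSL ℝ e)

theorem posSemidef_card_smul_one_sub_of_one [Fintype n] [DecidableEq n] :
    ((Fintype.card n : ℝ) • 1 - of fun _ _ : n => (1 : ℝ)).PosSemidef := by
  let b := EuclideanSpace.basisFun n ℝ
  have he : ‖(WithLp.toLp 2 fun _ => 1 : EuclideanSpace ℝ n)‖ ^ 2 = Fintype.card n := by
    simp [EuclideanSpace.norm_sq_eq]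
  rw [← he, ← gram_eq_one_iff_orthonormal.2 b.orthonormal]
  exact posSemidef_norm_sq_smul_gram_sub_one fun v => by
    simp [b, EuclideanSpace.inner_single_right]

theorem exists_inner_eq_ofReal (𝕜 : Type*) [RCLike 𝕜] [Finite n] {M : Matrix n n ℝ}
    (hM : M.PosSemidef) :
    ∃ x : n → EuclideanSpace 𝕜 (Fin (Nat.card n)),
      ∀ i j, inner 𝕜 (x i) (x j) = (M i j : 𝕜) := by
  cases nonempty_fintype n
  classical
  obtain ⟨B, rfl⟩ := CStarAlgebra.nonneg_iff_eq_star_mul_self.1 hM.nonneg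
  let e := Finite.equivFin n
  refine ⟨fun i => WithLp.toLp 2 fun k => (B (e.symm k) i : 𝕜), fun i j => ?_⟩
  simp only [PiLp.inner_apply, RCLike.inner_apply, RCLike.conj_ofReal, star_eq_conjTranspose,
    mul_apply, conjTranspose_apply, star_trivial, map_sum, map_mul]
  rw [e.symm.sum_comp fun k => (B k j : 𝕜) * (B k i : 𝕜)]
  simp only [mul_comm]

end Gram

section LovaszMatrix

variable {V : Type*} {G : SimpleGraph V} {c : ℝ} {N : Matrix V V ℝ}

/-- A feasible point of value `c` for the semidefinite program whose optimum is the Lovász number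
of the complement of `G`. -/
structure IsLovaszMatrix (G : SimpleGraph V) (c : ℝ) (N : Matrix V V ℝ) : Prop where
  posSemidef : N.PosSemidef
  diag : ∀ v, N v v = c - 1
  adj : ∀ v w, G.Adj v w → N v w = -1

/-- A feasible point of value `c` for Szegedy's strengthening of the Lovász number, in which
every entry is at least the value `-1` prescribed on the edges. -/
structure IsSzegedyMatrix (G : SimpleGraph V) (c : ℝ) (N : Matrix V V ℝ) : Prop
    extends IsLovaszMatrix G c N where
  neg_one_le : ∀ v w, -1 ≤ N v w

theorem isSzegedyMatrix_of_handle [Finite V] {E : Type*} [NormedAddCommGroup E]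
    [InnerProductSpace ℝ E] {e : E} {y : V → E} (he : ‖e‖ ^ 2 = c)
    (hey : ∀ v, inner ℝ e (y v) = 1) (hy : ∀ v, ‖y v‖ = 1)
    (hadj : ∀ v w, G.Adj v w → inner ℝ (y v) (y w) = 0)
    (hnonneg : ∀ v w, 0 ≤ inner ℝ (y v) (y w)) :
    IsSzegedyMatrix G c (c • gram ℝ y - of fun _ _ => 1) where
  posSemidef := he ▸ posSemidef_norm_sq_smul_gram_sub_one hey
  diag v := by simp [hy]
  adj v w h := by simp [hadj v w h]
  neg_one_le v w := by
    have hc : 0 ≤ c := he ▸ sq_nonneg _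
    simpa using mul_nonneg hc (hnonneg v w)

theorem IsLovaszMatrix.one_le [Nonempty V] (hN : IsLovaszMatrix G c N) : 1 ≤ c := by
  obtain ⟨v⟩ := ‹Nonempty V›
  exact sub_nonneg.1 (hN.diag v ▸ hN.posSemidef.diag_nonneg)

theorem IsLovaszMatrix.le_smul_diagonal [DecidableEq V] (hN : IsLovaszMatrix G c N)
    {W : Matrix V V ℝ} {b : V → ℝ} (hW : ∀ v w, ¬G.Adj v w → W v w = 0) (hb : -W ≤ diagonal b) :
    W ≤ (c - 1) • diagonal b := by
  have hprod : N ⊙ (diagonal b - -W) = (c - 1) • diagonal b - W := by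
    ext v w
    rcases eq_or_ne v w with rfl | hvw
    · simp [hN.diag, hW v v (G.irrefl)]
    · by_cases h : G.Adj v w
      · simp [hvw, hN.adj v w h]
      · simp [hvw, hW v w h]
  rw [le_iff, ← hprod]
  exact hN.posSemidef.hadamard hb

theorem IsLovaszMatrix.adjMatrix_le [DecidableEq V] [DecidableRel G.Adj]
    (hN : IsLovaszMatrix G c N) {b : V → ℝ} (hb : -G.adjMatrix ℝ ≤ diagonal b) :
    G.adjMatrix ℝ ≤ (c - 1) • diagonal b :=
  hN.le_smul_diagonal (fun v w h => by simp [h]) hb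

variable [Finite V]

theorem IsLovaszMatrix.abs_apply_le (hN : IsLovaszMatrix G c N) (v w : V) : |N v w| ≤ c - 1 := by
  obtain ⟨x, hx⟩ := exists_inner_eq_ofReal ℝ hN.posSemidef
  have hnorm : ∀ u, ‖x u‖ ^ 2 = c - 1 := fun u => by
    rw [← real_inner_self_eq_norm_sq, hx, hN.diag, RCLike.ofReal_real_eq_id, id]
  have hvw : |N v w| ≤ ‖x v‖ * ‖x w‖ := by
    simpa [hx] using abs_real_inner_le_norm (x v) (x w)
  nlinarith [hnorm v, hnorm w, sq_nonneg (‖x v‖ - ‖x w‖)]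

theorem IsLovaszMatrix.two_le_of_adj (hN : IsLovaszMatrix G c N) {v w : V} (h : G.Adj v w) :
    2 ≤ c := by
  have hone : |N v w| = 1 := by rw [hN.adj v w h, abs_neg, abs_one]
  linarith [hN.abs_apply_le v w]

end LovaszMatrix

section SpectralBounds

variable {V : Type*} [Fintype V] [DecidableEq V] {G : SimpleGraph V} [DecidableRel G.Adj]
  {c : ℝ} {N : Matrix V V ℝ}

theorem IsLovaszMatrix.smul_signlessLapMatrix_le (hN : IsLovaszMatrix G c N) (hc : 2 ≤ c) {μ θ : ℝ}
    (hA : G.adjMatrix ℝ ≤ algebraMap ℝ _ μ) (hL : G.lapMatrix ℝ ≤ algebraMap ℝ _ θ) :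
    (c - 1) • G.signlessLapMatrix ≤ algebraMap ℝ _ ((c - 1) * θ + (c - 2) * μ) := by
  have hdiag : (diagonal fun v => θ - (G.degree v : ℝ)) = algebraMap ℝ _ θ - G.degMatrix ℝ :=
    (diagonal_sub _ _).symm
  have hAc : G.adjMatrix ℝ ≤ (c - 1) • (algebraMap ℝ _ θ - G.degMatrix ℝ) := by
    rw [← hdiag]
    refine hN.adjMatrix_le ?_
    rw [hdiag, le_sub_iff_add_le', ← sub_eq_add_neg]
    exact hL
  calc
    (c - 1) • G.signlessLapMatrix
      = (c - 1) • G.degMatrix ℝ + (G.adjMatrix ℝ + (c - 2) • G.adjMatrix ℝ) := by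
        rw [signlessLapMatrix]
        module
    _ ≤ (c - 1) • G.degMatrix ℝ
          + ((c - 1) • (algebraMap ℝ _ θ - G.degMatrix ℝ) + (c - 2) • algebraMap ℝ _ μ) := by
        gcongr
    _ = algebraMap ℝ _ ((c - 1) * θ + (c - 2) * μ) := by
        simp only [Algebra.algebraMap_eq_smul_one]
        module

variable [Nonempty V]

theorem adjEigenvalues_firstIdx_nonneg (G : SimpleGraph V) [DecidableRel G.Adj] :
    0 ≤ G.adjEigenvalues (firstIdx V) := by
  have hle := (eigenvalues₀_firstIdx_le_iff (G.isHermitian_adjMatrix ℝ)).1 le_rfl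
  have htrace := (le_iff.1 hle).trace_nonneg
  simp only [trace_sub, trace_adjMatrix, algebraMap_eq_diagonal, trace_diagonal,
    Pi.algebraMap_apply, Finset.sum_const, Finset.card_univ, sub_zero, nsmul_eq_mul] at htrace
  exact nonneg_of_mul_nonneg_right htrace (Nat.cast_pos.2 Fintype.card_pos)

theorem adjEigenvalues_firstIdx_eq_zero_iff : G.adjEigenvalues (firstIdx V) = 0 ↔ G = ⊥ := by
  refine ⟨fun h => ?_, fun h => ?_⟩
  · have hle := (eigenvalues₀_firstIdx_le_iff (G.isHermitian_adjMatrix ℝ)).1 h.le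
    rw [map_zero, le_iff, zero_sub] at hle
    have hzero : G.adjMatrix ℝ = 0 :=
      neg_eq_zero.1 (hle.trace_eq_zero_iff.1 (by rw [trace_neg, trace_adjMatrix, neg_zero]))
    ext v w
    simpa using congr_fun₂ hzero v w
  · have hzero : G.adjMatrix ℝ = 0 := by
      ext v w
      simp [h]
    refine le_antisymm ((eigenvalues₀_firstIdx_le_iff _).2 ?_) (adjEigenvalues_firstIdx_nonneg G)
    rw [hzero, map_zero]

theorem adjEigenvalues_firstIdx_pos (hG : G ≠ ⊥) : 0 < G.adjEigenvalues (firstIdx V) :=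
  (adjEigenvalues_firstIdx_nonneg G).lt_of_ne' (adjEigenvalues_firstIdx_eq_zero_iff.not.2 hG)

theorem IsLovaszMatrix.adjEigenvalues_firstIdx_le (hN : IsLovaszMatrix G c N) :
    G.adjEigenvalues (firstIdx V) ≤ (c - 1) * -G.adjEigenvalues (lastIdx V) := by
  have hlast := (le_eigenvalues₀_lastIdx_iff (G.isHermitian_adjMatrix ℝ)).1 le_rfl
  have hb : -G.adjMatrix ℝ ≤ diagonal fun _ => -G.adjEigenvalues (lastIdx V) := by
    rw [← diagonal_neg]
    exact neg_le_neg hlast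
  refine (eigenvalues₀_firstIdx_le_iff _).2 ?_
  have := hN.adjMatrix_le hb
  rwa [← diagonal_smul] at this

theorem IsLovaszMatrix.two_mul_card_edgeFinset_le (hN : IsLovaszMatrix G c N) :
    2 * (G.edgeFinset.card : ℝ) ≤ (c - 1) * (2 * (G.edgeFinset.card : ℝ)
      - Fintype.card V * G.signlessLapEigenvalues (lastIdx V)) := by
  have hlast : algebraMap ℝ _ (G.signlessLapEigenvalues (lastIdx V)) ≤ G.signlessLapMatrix :=
    (le_eigenvalues₀_lastIdx_iff G.isHermitian_signlessLapMatrix).1 le_rfl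
  have hb : -G.adjMatrix ℝ ≤
      diagonal fun v => (G.degree v : ℝ) - G.signlessLapEigenvalues (lastIdx V) := by
    rw [← diagonal_sub, neg_le_sub_iff_le_add]
    exact hlast
  have hsum := (le_iff.1 (hN.adjMatrix_le hb)).dotProduct_mulVec_nonneg fun _ => 1
  have hdeg : ∑ v, (G.degree v : ℝ) = 2 * (G.edgeFinset.card : ℝ) := by
    exact_mod_cast G.sum_degrees_eq_twice_card_edges
  simp only [dotProduct, Pi.star_apply, star_trivial, sub_mulVec, smul_mulVec, Pi.sub_apply,
    Pi.smul_apply, mulVec_diagonal, mul_one, smul_eq_mul, adjMatrix_mulVec_apply, Finset.sum_const,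
    card_neighborFinset_eq_degree, nsmul_eq_mul, one_mul, Finset.sum_sub_distrib,
    ← Finset.mul_sum, hdeg, Finset.card_univ, sub_nonneg] at hsum
  exact hsum

theorem IsLovaszMatrix.adjEigenvalues_firstIdx_le_of_two_le (hN : IsLovaszMatrix G c N)
    (hc : 2 ≤ c) :
    G.adjEigenvalues (firstIdx V) ≤ (c - 1) * (G.adjEigenvalues (firstIdx V)
      - G.signlessLapEigenvalues (firstIdx V) + G.lapEigenvalues (firstIdx V)) := by
  set μ := G.adjEigenvalues (firstIdx V)
  set θ := G.lapEigenvalues (firstIdx V)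
  have hA : G.adjMatrix ℝ ≤ algebraMap ℝ _ μ :=
    (eigenvalues₀_firstIdx_le_iff (G.isHermitian_adjMatrix ℝ)).1 le_rfl
  have hL : G.lapMatrix ℝ ≤ algebraMap ℝ _ θ :=
    (eigenvalues₀_firstIdx_le_iff (G.isHermitian_lapMatrix ℝ)).1 le_rfl
  have hδ : G.signlessLapEigenvalues (firstIdx V) ≤ (c - 1)⁻¹ * ((c - 1) * θ + (c - 2) * μ) := by
    refine (eigenvalues₀_firstIdx_le_iff _).2 ?_
    rw [map_mul, ← Algebra.smul_def, le_inv_smul_iff_of_pos (by linarith)]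
    exact hN.smul_signlessLapMatrix_le hc hA hL
  rw [le_inv_mul_iff₀ (by linarith)] at hδ
  linarith

end SpectralBounds

section ColoringGram

variable {V : Type*} {G : SimpleGraph V} {c : ℕ} {N : Matrix V V ℝ}

theorem exists_isSzegedyMatrix [Finite V] [Nonempty V] (h : G.VectoriallyColorable c) :
    ∃ N, IsSzegedyMatrix G c N := by
  obtain ⟨H, _, _, _, x, hx⟩ := h
  obtain ⟨v₀⟩ := ‹Nonempty V›
  let := InnerProductSpace.rclikeToReal ℂ H
  let s := ∑ i, x v₀ i
  let e : PiLp 2 fun _ : Fin c => H := WithLp.toLp 2 fun _ => s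
  let y : V → PiLp 2 fun _ : Fin c => H := fun v => WithLp.toLp 2 (x v)
  have hself : ∀ v i, inner ℂ s (x v i) = inner ℂ (x v i) (x v i) := fun v i => by
    rw [show s = ∑ j, x v j from hx.sum_eq_sum v₀ v, sum_inner]
    exact Fintype.sum_eq_single i fun j hj => hx.inner_self_eq_zero v j i hj
  have hey : ∀ v, inner ℝ e (y v) = 1 := fun v => by
    simp only [e, y, PiLp.inner_apply]
    rw [← inner_sum, ← hx.sum_eq_sum v₀ v, real_inner_self_eq_norm_sq, hx.norm_sum, one_pow]
  have hy : ∀ v, inner ℝ (y v) (y v) = inner ℝ e (y v) := fun v => by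
    simp only [e, y, PiLp.inner_apply, real_inner_eq_re_inner ℂ, hself]
  refine ⟨_, isSzegedyMatrix_of_handle (e := e) (y := y) ?_ hey (fun v => ?_) (fun v w h => ?_)
    fun v w => ?_⟩
  · simp [e, s, PiLp.norm_sq_eq_of_L2, hx.norm_sum]
  · rw [← sq_eq_sq₀ (norm_nonneg _) zero_le_one, ← real_inner_self_eq_norm_sq, hy, hey, one_pow]
  · simp [y, PiLp.inner_apply, real_inner_eq_re_inner ℂ, hx.inner_adj_eq_zero v w h]
  · simp only [y, PiLp.inner_apply, real_inner_eq_re_inner ℂ]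
    exact Finset.sum_nonneg fun i _ => (RCLike.nonneg_iff.1 (hx.inner_nonneg v w i i)).1

/-- The Gram matrix of the vectorial `c`-coloring associated with a Szegedy matrix `N`. For `c = 1`
the quotient is `0 / 0 = 0` and all entries are `1`. -/
noncomputable def coloringGram (c : ℕ) (N : Matrix V V ℝ) : Matrix (V × Fin c) (V × Fin c) ℝ :=
  of fun p q =>
    ((c : ℝ) ^ 2)⁻¹ * (1 + N p.1 q.1 / (c - 1) * ((if p.2 = q.2 then (c : ℝ) else 0) - 1))

theorem posSemidef_coloringGram [Finite V] (hc : 0 < c) (hN : N.PosSemidef) :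
    (coloringGram c N).PosSemidef := by
  have hc' : (0 : ℝ) ≤ c - 1 := sub_nonneg.2 (by exact_mod_cast hc)
  have hones : (of fun _ _ => 1 : Matrix (V × Fin c) (V × Fin c) ℝ).PosSemidef := by
    simpa [gram] using posSemidef_gram ℝ fun _ : V × Fin c => (1 : ℝ)
  have hsimplex : ((c : ℝ) • 1 - of fun _ _ : Fin c => (1 : ℝ)).PosSemidef := by
    simpa only [Fintype.card_fin] using posSemidef_card_smul_one_sub_of_one (n := Fin c)
  convert (hones.add ((hN.kronecker hsimplex).smul (inv_nonneg.2 hc'))).smul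
    (inv_nonneg.2 (sq_nonneg (c : ℝ))) using 1
  ext ⟨v, i⟩ ⟨w, j⟩
  simp [coloringGram, one_apply, div_eq_inv_mul, mul_assoc]

theorem sum_sum_coloringGram (hc : 0 < c) (v w : V) :
    ∑ i, ∑ j, coloringGram c N (v, i) (w, j) = 1 := by
  have hc0 : (c : ℝ) ≠ 0 := Nat.cast_ne_zero.2 hc.ne'
  have hrow : ∀ i : Fin c, ∑ j, ((if i = j then (c : ℝ) else 0) - 1) = 0 := fun i => by simp
  simp only [coloringGram, of_apply, ← Finset.mul_sum, Finset.sum_add_distrib, hrow, mul_zero,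
    add_zero]
  simp only [Finset.sum_const, Finset.card_univ, Fintype.card_fin, nsmul_eq_mul, mul_one]
  field_simp

theorem coloringGram_self_eq_zero (hN : IsLovaszMatrix G c N) (v : V) {i j : Fin c} (hij : i ≠ j) :
    coloringGram c N (v, i) (v, j) = 0 := by
  have hc : (c : ℝ) - 1 ≠ 0 := sub_ne_zero.2 (by norm_cast; omega)
  simp [coloringGram, hij, hN.diag, hc]

variable [Finite V]

theorem coloringGram_nonneg (hN : IsSzegedyMatrix G c N) (p q : V × Fin c) :
    0 ≤ coloringGram c N p q := by
  have hle := (le_abs_self _).trans (hN.abs_apply_le p.1 q.1)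
  have hc : (0 : ℝ) ≤ c - 1 := (abs_nonneg _).trans (hN.abs_apply_le p.1 q.1)
  refine mul_nonneg (by positivity) ?_
  split_ifs
  · rcases hc.eq_or_lt with hc | hc
    · simp [← hc]
    · rw [div_mul_cancel₀ _ hc.ne']
      linarith [hN.neg_one_le p.1 q.1]
  · linarith [div_le_one_of_le₀ hle hc]

theorem coloringGram_adj_eq_zero (hN : IsLovaszMatrix G c N) {v w : V} (h : G.Adj v w) (i : Fin c) :
    coloringGram c N (v, i) (w, i) = 0 := by
  have hc : (c : ℝ) - 1 ≠ 0 := by linarith [hN.two_le_of_adj h]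
  simp [coloringGram, hN.adj v w h, hc]

theorem IsSzegedyMatrix.vectoriallyColorable (hN : IsSzegedyMatrix G c N) (hc : 0 < c) :
    G.VectoriallyColorable c := by
  obtain ⟨x, hx⟩ := exists_inner_eq_ofReal ℂ (posSemidef_coloringGram hc hN.posSemidef)
  have hsum : ∀ v w, inner ℂ (∑ i, x (v, i)) (∑ i, x (w, i)) = 1 := fun v w => by
    simp only [sum_inner, inner_sum, hx, ← RCLike.ofReal_sum]
    rw [Finset.sum_comm, sum_sum_coloringGram hc, RCLike.ofReal_one]
  have hnorm : ∀ v, ‖∑ i, x (v, i)‖ = 1 := fun v => by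
    rw [norm_eq_sqrt_re_inner (𝕜 := ℂ), hsum, RCLike.one_re, Real.sqrt_one]
  refine ⟨_, inferInstance, inferInstance, inferInstance, fun v i => x (v, i),
    fun v w i j => ?_, fun v w => ?_, hnorm, fun v i j hij => ?_, fun v w h i => ?_⟩
  · rw [hx]
    exact Complex.zero_le_real.2 (coloringGram_nonneg hN _ _)
  · exact (inner_eq_one_iff_of_norm_eq_one (hnorm v) (hnorm w)).1 (hsum v w)
  · simp [hx, coloringGram_self_eq_zero hN.toIsLovaszMatrix v hij]
  · simp [hx, coloringGram_adj_eq_zero hN.toIsLovaszMatrix h i]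

end ColoringGram

section OrthogonalRank

variable {V : Type*} {G : SimpleGraph V}

theorem exists_isSzegedyMatrix_of_orthogonal [Finite V] {E : Type*} [NormedAddCommGroup E]
    [InnerProductSpace ℂ E] [FiniteDimensional ℂ E] {x : V → E} (hx : ∀ v, x v ≠ 0)
    (hadj : ∀ v w, G.Adj v w → inner ℂ (x v) (x w) = 0) :
    ∃ N, IsSzegedyMatrix G (Module.finrank ℂ E) N := by
  let := InnerProductSpace.rclikeToReal ℂ E
  let b := stdOrthonormalBasis ℂ E
  let u : V → E := fun v => ((‖x v‖⁻¹ : ℝ) : ℂ) • x v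
  have hu : ∀ v, ‖u v‖ = 1 := fun v => by
    simp [u, norm_smul, norm_ne_zero_iff.2 (hx v)]
  let e : PiLp 2 fun _ : Fin (Module.finrank ℂ E) => E := WithLp.toLp 2 b
  let y : V → PiLp 2 fun _ : Fin (Module.finrank ℂ E) => E :=
    fun v => WithLp.toLp 2 fun i => inner ℂ (u v) (b i) • u v
  have hey : ∀ v, inner ℝ e (y v) = 1 := fun v => by
    simp only [e, y, PiLp.inner_apply, real_inner_eq_re_inner ℂ, inner_smul_right]
    rw [← map_sum, b.sum_inner_mul_inner, inner_self_eq_norm_sq, hu, one_pow]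
  have hy : ∀ v w, inner ℝ (y v) (y w) = ‖inner ℂ (u v) (u w)‖ ^ 2 := fun v w => by
    simp only [y, PiLp.inner_apply, real_inner_eq_re_inner ℂ, inner_smul_left, inner_smul_right]
    calc
      _ = RCLike.re (∑ i, inner ℂ (u w) (b i) * inner ℂ (b i) (u v) * inner ℂ (u v) (u w)) := by
        simp only [map_sum, inner_conj_symm]
        congr! 2
        ring
      _ = ‖inner ℂ (u v) (u w)‖ ^ 2 := by
        rw [← Finset.sum_mul, b.sum_inner_mul_inner, ← inner_conj_symm, RCLike.conj_mul]
        norm_cast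
  refine ⟨_, isSzegedyMatrix_of_handle (e := e) (y := y) ?_ hey (fun v => ?_) (fun v w h => ?_)
    fun v w => ?_⟩
  · simp [e, PiLp.norm_sq_eq_of_L2]
  · rw [← sq_eq_sq₀ (norm_nonneg _) zero_le_one, ← real_inner_self_eq_norm_sq, hy,
      inner_self_eq_norm_sq_to_K, hu]
    simp
  · simp [hy, u, hadj v w h]
  · rw [hy]
    positivity

theorem vectorialChromaticNumber_le_orthogonalRank [Finite V] [Nonempty V] (G : SimpleGraph V) :
    G.vectorialChromaticNumber ≤ G.orthogonalRank := by
  cases nonempty_fintype V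
  obtain ⟨hd, x, hx⟩ := Nat.sInf_mem G.exists_isOrthogonalRep
  obtain ⟨N, hN⟩ := exists_isSzegedyMatrix_of_orthogonal hx.ne_zero hx.inner_eq_zero
  rw [finrank_euclideanSpace_fin] at hN
  exact Nat.sInf_le (hN.vectoriallyColorable hd)

end OrthogonalRank

theorem pos_and_div_le {x y t : ℝ} (hx : 0 < x) (ht : 0 ≤ t) (h : x ≤ t * y) :
    0 < y ∧ x / y ≤ t := by
  have hy : 0 < y := pos_of_mul_pos_right (hx.trans_le h) ht
  exact ⟨hy, (div_le_iff₀ hy).2 h⟩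

end VectorialColoring

open VectorialColoring

/-- For the edgeless graph all three quotients are `0 / 0`, which is read as `0`; as soon as there
is an edge, all three denominators are positive, which is the first part of the conclusion. -/
theorem theorem2 {V : Type*} [Fintype V] [DecidableEq V] [Nonempty V]
    (G : SimpleGraph V) [DecidableRel G.Adj]
    (n m μ₁ μₙ δ₁ δₙ θ₁ : ℝ)
    (hn : n = (Fintype.card V : ℝ)) (hm : m = (G.edgeFinset.card : ℝ))
    (hμ₁ : μ₁ = G.adjEigenvalues (SimpleGraph.firstIdx V))
    (hμₙ : μₙ = G.adjEigenvalues (SimpleGraph.lastIdx V))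
    (hδ₁ : δ₁ = G.signlessLapEigenvalues (SimpleGraph.firstIdx V))
    (hδₙ : δₙ = G.signlessLapEigenvalues (SimpleGraph.lastIdx V))
    (hθ₁ : θ₁ = G.lapEigenvalues (SimpleGraph.firstIdx V)) :
    (G ≠ ⊥ → 0 < |μₙ| ∧ 0 < 2 * m - n * δₙ ∧ 0 < μ₁ - δ₁ + θ₁) ∧
    1 + max (μ₁ / |μₙ|) (max (2 * m / (2 * m - n * δₙ)) (μ₁ / (μ₁ - δ₁ + θ₁)))
      ≤ (G.vectorialChromaticNumber : ℝ) ∧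
    G.vectorialChromaticNumber ≤ G.orthogonalRank := by
  subst hn hm hμ₁ hμₙ hδ₁ hδₙ hθ₁
  obtain ⟨N, hS⟩ : ∃ N, IsSzegedyMatrix G G.vectorialChromaticNumber N :=
    exists_isSzegedyMatrix (Nat.sInf_mem G.exists_vectoriallyColorable)
  have hN := hS.toIsLovaszMatrix
  have hc : 0 ≤ (G.vectorialChromaticNumber : ℝ) - 1 := sub_nonneg.2 hN.one_le
  rw [← le_sub_iff_add_le', ← and_assoc]
  refine ⟨?_, vectorialChromaticNumber_le_orthogonalRank G⟩
  rcases eq_or_ne G ⊥ with hG | hG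
  · have hm : G.edgeFinset.card = 0 := by simpa using hG
    refine ⟨fun h => absurd hG h, ?_⟩
    rw [adjEigenvalues_firstIdx_eq_zero_iff.2 hG, hm]
    simpa using hc
  · obtain ⟨v, w, hvw⟩ := SimpleGraph.ne_bot_iff_exists_adj.1 hG
    have hμ := adjEigenvalues_firstIdx_pos hG
    have hm : 0 < (G.edgeFinset.card : ℝ) :=
      Nat.cast_pos.2 (Finset.card_pos.2 (SimpleGraph.edgeFinset_nonempty.2 hG))
    have h₁ := pos_and_div_le hμ hc
      (hN.adjEigenvalues_firstIdx_le.trans (mul_le_mul_of_nonneg_left (neg_le_abs _) hc))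
    have h₂ := pos_and_div_le (mul_pos two_pos hm) hc hN.two_mul_card_edgeFinset_le
    have h₃ := pos_and_div_le hμ hc
      (hN.adjEigenvalues_firstIdx_le_of_two_le (hN.two_le_of_adj hvw))
    exact ⟨fun _ => ⟨h₁.1, h₂.1, h₃.1⟩, max_le h₁.2 (max_le h₂.2 h₃.2)⟩
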